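/- Let $\Omega$ be a topological space and let $X$ be a complex locally convex topological vector space; neither is assumed to be Hausdorff, but if $X$ is not Hausdorff, then $\Omega$ is assumed to be a completely regular Hausdorff space. Let $C(\Omega,X)$ be the space of continuous functions $\Omega\to X$, let $C_b(\Omega,X)$ be the set of those with bounded range, and let $\mathcal{K}C(\Omega,X)=\{f\in C(\Omega,X):\overline{f(\Omega)}\text{ is compact}\}$. A zero-set of $\Omega$ is a set $h^{-1}(0)$ with $h\in C(\Omega,\mathbb{R})$. A subset $S\subset\Omega$ is called bounded if every $h\in C(\Omega,\mathbb{R})$ is bounded on $S$, and pseudocompact if every $h\in C(S,\mathbb{R})$ is bounded. The uniform, bounded-open and pseudocompact-open topologies are the topologies of uniform convergence on $\Omega$, on the closed bounded subsets of $\Omega$, and on the closed pseudocompact subsets of $\Omega$, respectively. Let $A\subset C(\Omega,\mathbb{C})$ and $W\subset C(\Omega,X)$. Assume: 1. either every $\varphi\in A$ takes values in $[0,1]$, or $A$ is a self-adjoint (i.e. closed under complex conjugation), not necessarily unital, subalgebra of $C(\Omega,\mathbb{C})$; 2. $A$ is a multiplier of $W$: $\varphi f+(1-\varphi)g\in W$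 for all $\varphi\in A$ and $f,g\in W$; 3. $A$ separates disjoint zero-sets of $\Omega$: for all zero-sets $Z_1,Z_2$ of $\Omega$ with $Z_1\cap Z_2=\emptyset$ there is $\varphi\in A$ with $\overline{\varphi(Z_1)}\cap\overline{\varphi(Z_2)}=\emptyset$ (closures in $\mathbb{C}$); 4. there is a dense subset $X_0\subset X$ such that, for each $x\in X_0$, the constant function with value $x$ belongs to $W$. Then the following hold. (a) If $W\subset\mathcal{K}C(\Omega,X)$ and every $\varphi\in A$ is bounded, then $W$ is dense in $\mathcal{K}C(\Omega,X)$ in the uniform topology. (b) If $X$ has the Heine--Borel property (every closed bounded subset of $X$ is compact), then $W$ is dense in $C(\Omega,X)$ in the bounded-open topology; if, in addition, every $\varphi\in A$ is bounded and $W\subset C_b(\Omega,X)$, then the closure of $W$ in $C(\Omega,X)$ in the uniform topology is $C_b(\Omega,X)$. (c) If $X$ is metrizable, in the sense that it has a countable local base at $0$, then $W$ is dense in $C(\Omega,X)$ in the pseudocompact-open topology. -/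

import Mathlib

open scoped Topology UniformConvergence

namespace SWApprox

section Sets

variable {Ω : Type*} [TopologicalSpace Ω]

/-- A zero-set of `Ω`: a set of the form `h ⁻¹ (0)` with `h` real-valued and continuous. -/
def IsZeroSet (S : Set Ω) : Prop :=
  ∃ h : C(Ω, ℝ), S = h ⁻¹' {0}

/-- A bounded subset of a topological space: every continuous real function on the whole space
is bounded on it. -/
def IsFunctionallyBounded (S : Set Ω) : Prop :=
  ∀ h : C(Ω, ℝ), Bornology.IsBounded (h '' S)

/-- A pseudocompact subset: every continuous real function on the subspace `S` is bounded. -/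
def IsPseudocompactSet (S : Set Ω) : Prop :=
  ∀ h : C(S, ℝ), Bornology.IsBounded (Set.range h)

/-- `A` separates disjoint zero-sets of `Ω`. Closures are taken in `ℂ`. -/
def SeparatesDisjointZeroSets (A : Set C(Ω, ℂ)) : Prop :=
  ∀ Z₁ Z₂ : Set Ω, IsZeroSet Z₁ → IsZeroSet Z₂ → Disjoint Z₁ Z₂ →
    ∃ φ ∈ A, Disjoint (closure (φ '' Z₁)) (closure (φ '' Z₂))

/-- All members of `A` take their values in `[0, 1]`. -/
def UnitIntervalValued (A : Set C(Ω, ℂ)) : Prop :=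
  ∀ φ ∈ A, ∀ t : Ω, φ t ∈ ((↑) : ℝ → ℂ) '' Set.Icc (0 : ℝ) 1

/-- `A` is a self-adjoint (not necessarily unital) complex subalgebra of `C(Ω, ℂ)`. -/
def IsSelfAdjointSubalgebra (A : Set C(Ω, ℂ)) : Prop :=
  ∃ B : NonUnitalStarSubalgebra ℂ C(Ω, ℂ), (B : Set C(Ω, ℂ)) = A

end Sets

section Functions

variable (Ω : Type*) [TopologicalSpace Ω]
variable (X : Type*) [AddCommGroup X] [Module ℂ X] [UniformSpace X]

/-- The space `C_b(Ω, X)` of continuous functions with (von Neumann) bounded range. -/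
def boundedFunctions : Set C(Ω, X) :=
  {f | Bornology.IsVonNBounded ℂ (Set.range f)}

/-- The space `𝒦C(Ω, X)` of continuous functions whose range has compact closure. -/
def relCompactRange : Set C(Ω, X) :=
  {f | IsCompact (closure (Set.range f))}

/-- The Heine-Borel property: closed bounded subsets are compact. -/
def HeineBorel : Prop :=
  ∀ S : Set X, IsClosed S → Bornology.IsVonNBounded ℂ S → IsCompact S

/-- The topology on `C(Ω, X)` of uniform convergence on `Ω`. -/
abbrev uniformTopology : TopologicalSpace C(Ω, X) :=
  TopologicalSpace.induced (fun f : C(Ω, X) ↦ UniformFun.ofFun (f : Ω → X)) inferInstance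

/-- The topology on `C(Ω, X)` of uniform convergence on the members of `𝔖`. -/
abbrev uniformOnTopology (𝔖 : Set (Set Ω)) : TopologicalSpace C(Ω, X) :=
  TopologicalSpace.induced (fun f : C(Ω, X) ↦ UniformOnFun.ofFun 𝔖 (f : Ω → X)) inferInstance

/-- The bounded-open topology: uniform convergence on the closed bounded subsets of `Ω`. -/
abbrev boundedOpenTopology : TopologicalSpace C(Ω, X) :=
  uniformOnTopology Ω X {K | IsClosed K ∧ IsFunctionallyBounded K}

/-- The pseudocompact-open topology: uniform convergence on the closed pseudocompact subsets. -/
abbrev pseudocompactOpenTopology : TopologicalSpace C(Ω, X) :=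
  uniformOnTopology Ω X {K | IsClosed K ∧ IsPseudocompactSet K}

variable {Ω X}

/-- `A` is a multiplier of `W`: `φ f + (1 - φ) g ∈ W` for all `φ ∈ A` and `f, g ∈ W`. -/
def IsMultiplier [IsUniformAddGroup X] [ContinuousSMul ℂ X]
    (A : Set C(Ω, ℂ)) (W : Set C(Ω, X)) : Prop :=
  ∀ φ ∈ A, ∀ f ∈ W, ∀ g ∈ W, φ • f + (1 - φ) • g ∈ W

/-- `W` contains the constant functions with values in some dense subset of `X`. -/
def ContainsDenseConstants (W : Set C(Ω, X)) : Prop :=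
  ∃ X₀ : Set X, Dense X₀ ∧ ∀ x ∈ X₀, ContinuousMap.const Ω x ∈ W

end Functions

end SWApprox

/-! Multipliers with values in `[0, 1]` on `K` are closed under complements and products, so
polynomials `(1 - φ ^ n) ^ m` turn a gap between values of `φ` into almost a 0-1 switch. Compactness
of the sets of values of `φ` glues such switches, so disjoint zero-sets are separated almost
perfectly on any `K` where `A` is bounded (`multipliersSeparate_zeroSets`). Given a continuous
seminorm for which `f(K)` is totally bounded, constants of `W` near `f(K)` are then blended one at a
time by these switches, the final error not depending on how many there are
(`exists_approx_of_finite`). Total boundedness is immediate for relatively compact range. On a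
functionally bounded `K` it always holds: a separated sequence in `f(K)` would give an unbounded
continuous function. The pseudocompact-open case follows from the bounded-open one. -/

namespace SWApprox

open Filter

/-- The powers `(1 - x ^ n) ^ m` approximate a threshold between `a` and `b`. -/
theorem exists_threshold {a b : ℝ} (ha : 0 ≤ a) (hab : a < b) (hb : b ≤ 1) {ε : ℝ} (hε : 0 < ε) :
    ∃ n m : ℕ, (∀ x, 0 ≤ x → x ≤ a → 1 - ε ≤ (1 - x ^ n) ^ m) ∧
      ∀ x, b ≤ x → x ≤ 1 → (1 - x ^ n) ^ m ≤ ε := by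
  obtain ⟨c, hac, hcb⟩ := exists_between hab
  have hc : 0 < c := ha.trans_lt hac
  have h1 : Tendsto (fun n : ℕ ↦ (a / c) ^ n + a ^ n) atTop (𝓝 (0 + 0)) :=
    (tendsto_pow_atTop_nhds_zero_of_lt_one (by positivity) ((div_lt_one hc).2 hac)).add
      (tendsto_pow_atTop_nhds_zero_of_lt_one ha (hab.trans_le hb))
  have h2 : Tendsto (fun n : ℕ ↦ (b / c) ^ n) atTop atTop :=
    tendsto_pow_atTop_atTop_of_one_lt ((one_lt_div hc).2 hcb)
  obtain ⟨n, hn1, hn2⟩ := ((h1.eventually_le_const (by simpa using hε)).and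
    (h2.eventually_ge_atTop ε⁻¹)).exists
  -- With `m ≈ c⁻ⁿ`, `m * x ^ n` is tiny for `x ≤ a` (Bernoulli applies) and huge for `x ≥ b`
  -- (compare with `exp`).
  refine ⟨n, ⌈(c ^ n)⁻¹⌉₊, fun x hx hxa ↦ ?_, fun x hbx hx ↦ ?_⟩
  · have hxn : x ^ n ≤ a ^ n := pow_le_pow_left₀ hx hxa n
    have hx1 : x ^ n ≤ 1 := pow_le_one₀ hx (hxa.trans (hab.le.trans hb))
    have hm : (⌈(c ^ n)⁻¹⌉₊ : ℝ) ≤ (c ^ n)⁻¹ + 1 := (Nat.ceil_lt_add_one (by positivity)).le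
    have hB := one_add_mul_le_pow (a := -x ^ n) (by linarith) ⌈(c ^ n)⁻¹⌉₊
    have : (⌈(c ^ n)⁻¹⌉₊ : ℝ) * x ^ n ≤ ((c ^ n)⁻¹ + 1) * a ^ n :=
      mul_le_mul hm hxn (by positivity) (by positivity)
    have e : ((c ^ n)⁻¹ + 1) * a ^ n = (a / c) ^ n + a ^ n := by
      rw [div_pow]; ring
    rw [← sub_eq_add_neg] at hB
    linarith
  · have hb0 : 0 < b := hc.trans hcb
    have hx0 : 0 ≤ x := hb0.le.trans hbx
    have hx1 : x ^ n ≤ 1 := pow_le_one₀ hx0 hx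
    have hxn : b ^ n ≤ x ^ n := pow_le_pow_left₀ hb0.le hbx n
    have hm : (c ^ n)⁻¹ ≤ (⌈(c ^ n)⁻¹⌉₊ : ℝ) := Nat.le_ceil _
    have h3 : ε⁻¹ ≤ (⌈(c ^ n)⁻¹⌉₊ : ℝ) * x ^ n := by
      refine hn2.trans ?_
      rw [div_pow, div_eq_inv_mul]
      exact mul_le_mul hm hxn (by positivity) (by positivity)
    calc (1 - x ^ n) ^ ⌈(c ^ n)⁻¹⌉₊ ≤ (Real.exp (-x ^ n)) ^ ⌈(c ^ n)⁻¹⌉₊ :=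
          pow_le_pow_left₀ (by linarith) (Real.one_sub_le_exp_neg _) _
      _ = (Real.exp (⌈(c ^ n)⁻¹⌉₊ * x ^ n))⁻¹ := by
          rw [← Real.exp_nat_mul, ← Real.exp_neg]; ring_nf
      _ ≤ (ε⁻¹)⁻¹ := by
          gcongr
          linarith [Real.add_one_le_exp ((⌈(c ^ n)⁻¹⌉₊ : ℝ) * x ^ n)]
      _ = ε := inv_inv ε

/-! ### Separation by multipliers -/

section Multipliers

variable {Ω : Type*} [TopologicalSpace Ω]
variable {X : Type*} [AddCommGroup X] [Module ℂ X] [UniformSpace X] [IsUniformAddGroup X]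
  [ContinuousSMul ℂ X]

/-- The multipliers of `W` whose values on `K` lie in `[0, 1]`. -/
def unitMultipliers (W : Set C(Ω, X)) (K : Set Ω) : Set C(Ω, ℂ) :=
  {φ | (∀ f ∈ W, ∀ g ∈ W, φ • f + (1 - φ) • g ∈ W) ∧
    ∀ t ∈ K, φ t ∈ ((↑) : ℝ → ℂ) '' Set.Icc (0 : ℝ) 1}

variable {W : Set C(Ω, X)} {K : Set Ω} {φ ψ : C(Ω, ℂ)}

theorem re_mem_Icc_of_mem_unitMultipliers (hφ : φ ∈ unitMultipliers W K) {t : Ω} (ht : t ∈ K) :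
    (φ t).re ∈ Set.Icc (0 : ℝ) 1 := by
  obtain ⟨r, hr, h⟩ := hφ.2 t ht
  simpa [← h] using hr

theorem ofReal_re_of_mem_unitMultipliers (hφ : φ ∈ unitMultipliers W K) {t : Ω} (ht : t ∈ K) :
    ((φ t).re : ℂ) = φ t := by
  obtain ⟨r, hr, h⟩ := hφ.2 t ht
  simp [← h]

theorem one_sub_mem_unitMultipliers (hφ : φ ∈ unitMultipliers W K) :
    1 - φ ∈ unitMultipliers W K := by
  refine ⟨fun f hf g hg ↦ ?_, fun t ht ↦ ?_⟩
  · simpa [add_comm] using hφ.1 g hg f hf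
  · obtain ⟨r, hr, h⟩ := hφ.2 t ht
    exact ⟨1 - r, ⟨by linarith [hr.2], by linarith [hr.1]⟩, by simp [← h]⟩

/-- Nested blending: `φψ f + (1 - φψ) g = φ (ψ f + (1 - ψ) g) + (1 - φ) g`. -/
theorem mul_mem_unitMultipliers (hφ : φ ∈ unitMultipliers W K) (hψ : ψ ∈ unitMultipliers W K) :
    φ * ψ ∈ unitMultipliers W K := by
  refine ⟨fun f hf g hg ↦ ?_, fun t ht ↦ ?_⟩
  · convert hφ.1 _ (hψ.1 f hf g hg) g hg using 1
    ext t
    simp only [ContinuousMap.add_apply, ContinuousMap.smul_apply', ContinuousMap.mul_apply,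
      ContinuousMap.sub_apply, ContinuousMap.one_apply]
    module
  · obtain ⟨r, hr, h⟩ := hφ.2 t ht
    obtain ⟨s, hs, h'⟩ := hψ.2 t ht
    exact ⟨r * s, ⟨mul_nonneg hr.1 hs.1, mul_le_one₀ hr.2 hs.1 hs.2⟩, by simp [← h, ← h']⟩

theorem one_mem_unitMultipliers : (1 : C(Ω, ℂ)) ∈ unitMultipliers W K :=
  ⟨fun f hf g _ ↦ by convert hf using 1; ext t; simp, fun t _ ↦ ⟨1, by simp, by simp⟩⟩

theorem pow_mem_unitMultipliers (hφ : φ ∈ unitMultipliers W K) (n : ℕ) :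
    φ ^ n ∈ unitMultipliers W K := by
  induction n with
  | zero => simpa using one_mem_unitMultipliers
  | succ n ih => rw [pow_succ]; exact mul_mem_unitMultipliers ih hφ

/-- Multipliers of `W` with values in `[0, 1]` on `K` come arbitrarily close to the value `1`
on `S ∩ K` and `0` on `T ∩ K`. -/
def MultipliersSeparate (W : Set C(Ω, X)) (K S T : Set Ω) : Prop :=
  ∀ ε > 0, ∃ φ ∈ unitMultipliers W K,
    (∀ t ∈ K, t ∈ S → 1 - ε ≤ (φ t).re) ∧ ∀ t ∈ K, t ∈ T → (φ t).re ≤ ε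

variable {S S' T T' : Set Ω}

theorem MultipliersSeparate.symm (h : MultipliersSeparate W K S T) :
    MultipliersSeparate W K T S := by
  intro ε hε
  obtain ⟨φ, hφ, h1, h2⟩ := h ε hε
  refine ⟨1 - φ, one_sub_mem_unitMultipliers hφ, fun t ht htS ↦ ?_, fun t ht htT ↦ ?_⟩
  · exact sub_le_sub_left (h2 t ht htS) 1
  · exact sub_le_comm.1 (h1 t ht htT)

theorem MultipliersSeparate.mono (h : MultipliersSeparate W K S T) (hS : S' ∩ K ⊆ S)
    (hT : T' ∩ K ⊆ T) : MultipliersSeparate W K S' T' := by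
  intro ε hε
  obtain ⟨φ, hφ, h1, h2⟩ := h ε hε
  exact ⟨φ, hφ, fun t ht htS ↦ h1 t ht (hS ⟨htS, ht⟩), fun t ht htT ↦ h2 t ht (hT ⟨htT, ht⟩)⟩

theorem multipliersSeparate_empty_right : MultipliersSeparate W K S ∅ := fun ε hε ↦
  ⟨1, one_mem_unitMultipliers, fun t _ _ ↦ by simpa using hε.le, fun t _ h ↦ h.elim⟩

theorem MultipliersSeparate.union_right (h : MultipliersSeparate W K S T)
    (h' : MultipliersSeparate W K S T') : MultipliersSeparate W K S (T ∪ T') := by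
  intro ε hε
  obtain ⟨φ, hφ, h1, h2⟩ := h (ε / 2) (by positivity)
  obtain ⟨ψ, hψ, h3, h4⟩ := h' (ε / 2) (by positivity)
  have key : ∀ t ∈ K, ((φ * ψ) t).re = (φ t).re * (ψ t).re := fun t ht ↦ by
    rw [ContinuousMap.mul_apply, ← ofReal_re_of_mem_unitMultipliers hφ ht,
      ← ofReal_re_of_mem_unitMultipliers hψ ht, ← Complex.ofReal_mul]
    simp
  refine ⟨φ * ψ, mul_mem_unitMultipliers hφ hψ, fun t ht htS ↦ ?_, fun t ht htT ↦ ?_⟩ <;>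
    rw [key t ht] <;>
    obtain ⟨a0, a1⟩ := re_mem_Icc_of_mem_unitMultipliers hφ ht <;>
    obtain ⟨b0, b1⟩ := re_mem_Icc_of_mem_unitMultipliers hψ ht
  · nlinarith [h1 t ht htS, h3 t ht htS, mul_nonneg (sub_nonneg.2 a1) (sub_nonneg.2 b1)]
  · rcases htT with htT | htT
    · nlinarith [h2 t ht htT, mul_nonneg a0 (sub_nonneg.2 b1)]
    · nlinarith [h4 t ht htT, mul_nonneg b0 (sub_nonneg.2 a1)]

theorem multipliersSeparate_of_threshold (hφ : φ ∈ unitMultipliers W K) {a b : ℝ} (ha : 0 ≤ a)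
    (hab : a < b) (hb : b ≤ 1) :
    MultipliersSeparate W K {t | (φ t).re ≤ a} {t | b ≤ (φ t).re} := by
  intro ε hε
  obtain ⟨n, m, h1, h2⟩ := exists_threshold ha hab hb hε
  have key : ∀ t ∈ K, (((1 - φ ^ n) ^ m : C(Ω, ℂ)) t).re = (1 - (φ t).re ^ n) ^ m :=
    fun t ht ↦ by
      rw [ContinuousMap.pow_apply, ContinuousMap.sub_apply, ContinuousMap.pow_apply,
        ContinuousMap.one_apply, ← ofReal_re_of_mem_unitMultipliers hφ ht]
      norm_cast
  refine ⟨(1 - φ ^ n) ^ m, pow_mem_unitMultipliers (one_sub_mem_unitMultipliers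
    (pow_mem_unitMultipliers hφ n)) m, fun t ht htS ↦ ?_, fun t ht htT ↦ ?_⟩ <;> rw [key t ht]
  · exact h1 _ (re_mem_Icc_of_mem_unitMultipliers hφ ht).1 htS
  · exact h2 _ htT (re_mem_Icc_of_mem_unitMultipliers hφ ht).2

/-- Disjoint compact sets of values of `φ` are separated as soon as any two distinct values in
them are distinguished by a multiplier which is a continuous function of `φ`. -/
theorem multipliersSeparate_preimage {C D : Set ℂ} (hC : IsCompact C) (hD : IsCompact D)
    (h : ∀ z ∈ C, ∀ w ∈ D, ∃ ψ ∈ unitMultipliers W K, ∃ P : ℂ → ℝ, Continuous P ∧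
      (∀ t ∈ K, (ψ t).re = P (φ t)) ∧ P z ∈ Set.Icc (0 : ℝ) 1 ∧ P w ∈ Set.Icc (0 : ℝ) 1 ∧
        P z ≠ P w) :
    MultipliersSeparate W K (φ ⁻¹' C) (φ ⁻¹' D) := by
  have local_sep : ∀ z ∈ C, ∀ w ∈ D, ∃ U ∈ 𝓝 z, ∃ V ∈ 𝓝 w,
      MultipliersSeparate W K (φ ⁻¹' U) (φ ⁻¹' V) := by
    intro z hz w hw
    obtain ⟨ψ, hψ, P, hP, hψP, hPz, hPw, hne⟩ := h z hz w hw
    rcases lt_or_gt_of_ne hne with hlt | hlt <;>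
      obtain ⟨a, ha1, ha2⟩ := exists_between hlt <;>
      obtain ⟨b, hb1, hb2⟩ := exists_between ha2
    · have hs := multipliersSeparate_of_threshold hψ (hPz.1.trans ha1.le) hb1
        (hb2.le.trans hPw.2)
      refine ⟨_, hP.continuousAt.eventually_lt continuousAt_const ha1, _,
        continuousAt_const.eventually_lt hP.continuousAt hb2, hs.mono ?_ ?_⟩
      · rintro t ⟨ht, htK⟩; simpa [hψP t htK] using le_of_lt ht
      · rintro t ⟨ht, htK⟩; simpa [hψP t htK] using le_of_lt ht
    · have hs := multipliersSeparate_of_threshold hψ (hPw.1.trans ha1.le) hb1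
        (hb2.le.trans hPz.2)
      refine ⟨_, continuousAt_const.eventually_lt hP.continuousAt hb2, _,
        hP.continuousAt.eventually_lt continuousAt_const ha1, hs.symm.mono ?_ ?_⟩
      · rintro t ⟨ht, htK⟩; simpa [hψP t htK] using le_of_lt ht
      · rintro t ⟨ht, htK⟩; simpa [hψP t htK] using le_of_lt ht
  have right : ∀ z ∈ C, ∃ U ∈ 𝓝 z, MultipliersSeparate W K (φ ⁻¹' U) (φ ⁻¹' D) := by
    intro z hz
    refine hD.induction_on (p := fun D ↦ ∃ U ∈ 𝓝 z, MultipliersSeparate W K (φ ⁻¹' U) (φ ⁻¹' D))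
      ⟨Set.univ, univ_mem, multipliersSeparate_empty_right⟩ ?_ ?_ ?_
    · rintro s t hst ⟨U, hU, hs⟩
      exact ⟨U, hU, hs.mono Set.inter_subset_left fun x hx ↦ hst hx.1⟩
    · rintro s t ⟨U, hU, hs⟩ ⟨V, hV, ht⟩
      refine ⟨U ∩ V, inter_mem hU hV, ?_⟩
      rw [Set.preimage_union]
      exact (hs.mono (fun x hx ↦ hx.1.1) Set.inter_subset_left).union_right
        (ht.mono (fun x hx ↦ hx.1.2) Set.inter_subset_left)
    · intro w hw
      obtain ⟨U, hU, V, hV, hs⟩ := local_sep z hz w hw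
      exact ⟨V, mem_nhdsWithin_of_mem_nhds hV, U, hU, hs⟩
  -- Unions are available only on the right, so the sides are swapped for the second compactness
  -- argument.
  refine MultipliersSeparate.symm (hC.induction_on
    (p := fun C ↦ MultipliersSeparate W K (φ ⁻¹' D) (φ ⁻¹' C)) multipliersSeparate_empty_right
    (fun s t hst ht ↦ ht.mono Set.inter_subset_left fun x hx ↦ hst hx.1)
    (fun s t hs ht ↦ hs.union_right ht) fun z hz ↦ ?_)
  obtain ⟨U, hU, hs⟩ := right z hz
  exact ⟨U, mem_nhdsWithin_of_mem_nhds hU, hs.symm⟩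

/-- Disjoint zero-sets are separated by multipliers, relative to a set on which every member
of `A` is bounded. -/
theorem multipliersSeparate_zeroSets {A : Set C(Ω, ℂ)}
    (hA : UnitIntervalValued A ∨ IsSelfAdjointSubalgebra A) (hAW : IsMultiplier A W)
    (hsep : SeparatesDisjointZeroSets A) (hK : ∀ φ ∈ A, Bornology.IsBounded (φ '' K))
    {Z₁ Z₂ : Set Ω} (h₁ : IsZeroSet Z₁) (h₂ : IsZeroSet Z₂) (hd : Disjoint Z₁ Z₂) :
    MultipliersSeparate W K Z₁ Z₂ := by
  obtain ⟨φ, hφ, hdφ⟩ := hsep Z₁ Z₂ h₁ h₂ hd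
  have hcl : ∀ Z : Set Ω, IsCompact (closure (φ '' (Z ∩ K))) := fun Z ↦
    ((hK φ hφ).subset (Set.image_mono Set.inter_subset_right)).isCompact_closure
  refine (multipliersSeparate_preimage (φ := φ) (hcl Z₁) (hcl Z₂) fun z hz w hw ↦ ?_).mono
    (fun t ht ↦ subset_closure ⟨t, ht, rfl⟩) (fun t ht ↦ subset_closure ⟨t, ht, rfl⟩)
  have hzw : z ≠ w := hdφ.ne_of_mem (closure_mono (Set.image_mono Set.inter_subset_left) hz)
    (closure_mono (Set.image_mono Set.inter_subset_left) hw)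
  rcases hA with hA | ⟨B, rfl⟩
  · have hI : IsClosed (((↑) : ℝ → ℂ) '' Set.Icc (0 : ℝ) 1) :=
      (isCompact_Icc.image Complex.continuous_ofReal).isClosed
    have hZ : ∀ Z : Set Ω, closure (φ '' (Z ∩ K)) ⊆ ((↑) : ℝ → ℂ) '' Set.Icc (0 : ℝ) 1 :=
      fun Z ↦ closure_minimal (by rintro _ ⟨t, -, rfl⟩; exact hA φ hφ t) hI
    obtain ⟨r, hr, rfl⟩ := hZ _ hz
    obtain ⟨s, hs, rfl⟩ := hZ _ hw
    exact ⟨φ, ⟨hAW φ hφ, fun t _ ↦ hA φ hφ t⟩, Complex.re, Complex.continuous_re,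
      fun _ _ ↦ rfl, by simpa using hr, by simpa using hs, by simpa using hzw⟩
  -- Without a unit, only polynomials with zero constant term are usable. If `μ = 0` fails, then
  -- `|z| = |w| ≠ 0`, and equality for `μ = conj (z - w)` would give `|1 + μz| = |1 + μw|`, hence
  -- `Re (μ(z - w)) = |z - w|² = 0`.
  · obtain ⟨μ, hμ⟩ : ∃ μ : ℂ, ‖z + μ * z ^ 2‖ ^ 2 ≠ ‖w + μ * w ^ 2‖ ^ 2 := by
      by_contra! hcon
      have h0 : ‖z‖ ^ 2 = ‖w‖ ^ 2 := by simpa using hcon 0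
      have h1 := hcon (starRingEnd ℂ (z - w))
      have e : ∀ u v : ℂ, ‖u + v * u ^ 2‖ ^ 2 = ‖u‖ ^ 2 * ‖1 + v * u‖ ^ 2 := fun u v ↦ by
        rw [← mul_pow, ← norm_mul]; ring_nf
      rw [e, e, ← h0] at h1
      have hz0 : ‖z‖ ^ 2 ≠ 0 := by
        intro h
        have hz0 : z = 0 := by simpa using h
        have hw0 : w = 0 := by simpa [hz0] using h0.symm
        exact hzw (hz0.trans hw0.symm)
      have h2 := mul_left_cancel₀ hz0 h1
      have h3 : 0 < ‖z - w‖ ^ 2 := by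
        have := sub_ne_zero.2 hzw
        positivity
      simp only [← Complex.normSq_eq_norm_sq, Complex.normSq_apply, Complex.add_re,
        Complex.mul_re, Complex.add_im, Complex.mul_im, Complex.conj_re, Complex.conj_im,
        Complex.sub_re, Complex.sub_im, Complex.one_re, Complex.one_im] at h0 h2 h3
      nlinarith
    set χ : C(Ω, ℂ) := φ + μ • (φ * φ) with hχ
    have hχA : χ ∈ B := add_mem hφ (SMulMemClass.smul_mem μ (mul_mem hφ hφ))
    obtain ⟨R, hR⟩ := (hK χ hχA).exists_norm_le
    -- Scales `|χ|²` into `[0, 1]` on `K`; the `max` keeps the divisor positive.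
    set c : ℝ := (max R 1 ^ 2)⁻¹ with hc
    have hR1 : 0 < max R 1 := lt_max_of_lt_right one_pos
    have hc0 : 0 < c := by positivity
    set P : ℂ → ℝ := fun u ↦ c * ‖u + μ * u ^ 2‖ ^ 2 with hPdef
    have hP : Continuous P := by fun_prop
    have hχP : ∀ t, P (φ t) = c * ‖χ t‖ ^ 2 := fun t ↦ by
      simp [hPdef, hχ, pow_two]
    have hPK : ∀ t ∈ K, P (φ t) ∈ Set.Icc (0 : ℝ) 1 := fun t ht ↦ by
      rw [hχP]
      refine ⟨by positivity, ?_⟩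
      rw [hc, inv_mul_le_one₀ (by positivity)]
      exact pow_le_pow_left₀ (norm_nonneg _) ((hR _ ⟨t, ht, rfl⟩).trans (le_max_left _ _)) 2
    have hψ : ∀ t, ((c : ℂ) • (star χ * χ)) t = ((P (φ t) : ℝ) : ℂ) := fun t ↦ by
      rw [hχP]
      simp [← Complex.normSq_eq_norm_sq, Complex.normSq_eq_conj_mul_self]
    have hZ : ∀ Z : Set Ω, ∀ u ∈ closure (φ '' (Z ∩ K)), P u ∈ Set.Icc (0 : ℝ) 1 :=
      fun Z u hu ↦ closure_minimal (t := P ⁻¹' Set.Icc 0 1)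
        (by rintro _ ⟨t, ht, rfl⟩; exact hPK t ht.2) (isClosed_Icc.preimage hP) hu
    refine ⟨(c : ℂ) • (star χ * χ), ⟨hAW _ (SMulMemClass.smul_mem (c : ℂ)
      (mul_mem (star_mem hχA) hχA)), fun t ht ↦ ⟨_, hPK t ht, (hψ t).symm⟩⟩, P, hP,
      fun t _ ↦ by rw [hψ, Complex.ofReal_re], hZ _ z hz, hZ _ w hw, ?_⟩
    exact fun h ↦ hμ (mul_left_cancel₀ hc0.ne' h)

end Multipliers

open scoped Pointwise

/-! ### Zero-sets and closures in the function-space topologies -/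

section Topologies

variable {Ω : Type*} [TopologicalSpace Ω]

theorem isZeroSet_le (d : C(Ω, ℝ)) (a : ℝ) : IsZeroSet {t | d t ≤ a} :=
  ⟨⟨fun t ↦ max (d t - a) 0, by fun_prop⟩, by ext t; simp⟩

theorem isZeroSet_ge (d : C(Ω, ℝ)) (a : ℝ) : IsZeroSet {t | a ≤ d t} :=
  ⟨⟨fun t ↦ max (a - d t) 0, by fun_prop⟩, by ext t; simp⟩

variable {X : Type*} [UniformSpace X] {W : Set C(Ω, X)} {K : Set Ω}

theorem mem_closure_uniformTopology {f : C(Ω, X)} :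
    f ∈ closure[uniformTopology Ω X] W ↔
      ∀ V ∈ uniformity X, ∃ g ∈ W, ∀ t, (f t, g t) ∈ V := by
  rw [closure_induced, mem_closure_iff_nhds_basis (UniformFun.hasBasis_nhds Ω X _)]
  simp only [Set.exists_mem_image]
  rfl

theorem isFunctionallyBounded_of_isPseudocompactSet (hK : IsPseudocompactSet K) :
    IsFunctionallyBounded K := fun h ↦ by
  simpa [Set.range_comp] using hK (h.comp ⟨Subtype.val, continuous_subtype_val⟩)

theorem mem_closure_boundedOpenTopology {f : C(Ω, X)}
    (h : ∀ K, IsFunctionallyBounded K → ∀ V ∈ uniformity X, ∃ g ∈ W, ∀ t ∈ K, (g t, f t) ∈ V) :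
    f ∈ closure[boundedOpenTopology Ω X] W := by
  have hne : {K : Set Ω | IsClosed K ∧ IsFunctionallyBounded K}.Nonempty :=
    ⟨∅, isClosed_empty, fun h ↦ by simp⟩
  rw [closure_induced, mem_closure_iff_nhds_basis (UniformOnFun.hasBasis_nhds Ω X _ _ hne ?_)]
  · rintro ⟨K, V⟩ ⟨⟨-, hK⟩, hV⟩
    obtain ⟨g, hg, hgV⟩ := h K hK V hV
    exact ⟨_, ⟨g, hg, rfl⟩, hgV⟩
  · rintro S ⟨hS, hS'⟩ T ⟨hT, hT'⟩
    refine ⟨S ∪ T, ⟨hS.union hT, fun h ↦ ?_⟩, Set.subset_union_left, Set.subset_union_right⟩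
    rw [Set.image_union]
    exact (hS' h).union (hT' h)

theorem boundedOpenTopology_le_pseudocompactOpenTopology :
    boundedOpenTopology Ω X ≤ pseudocompactOpenTopology Ω X :=
  induced_mono (UniformSpace.toTopologicalSpace_mono (UniformOnFun.mono le_rfl
    fun _ hK ↦ ⟨hK.1, isFunctionallyBounded_of_isPseudocompactSet hK.2⟩))

end Topologies

theorem preimage_sub_mem_uniformity {X : Type*} [AddCommGroup X] [UniformSpace X]
    [IsUniformAddGroup X] {U : Set X} (hU : U ∈ 𝓝 (0 : X)) :
    {q : X × X | q.1 - q.2 ∈ U} ∈ uniformity X := by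
  rw [uniformity_eq_comap_nhds_zero_swapped]
  exact preimage_mem_comap (m := fun q : X × X ↦ q.1 - q.2) hU

theorem continuousSMul_real_of_complex {X : Type*} [AddCommGroup X] [Module ℂ X] [TopologicalSpace X]
    [ContinuousSMul ℂ X] : ContinuousSMul ℝ X where
  continuous_smul := by
    simp_rw [← Complex.coe_smul]
    fun_prop

/-! ### Bounded sets and uniform limits of bounded functions -/

section Bounded

variable {X : Type*} [AddCommGroup X] [Module ℂ X] [UniformSpace X] [IsUniformAddGroup X]
  [ContinuousSMul ℂ X]

/-- For a balanced `N` with `N + N ⊆ U`, `N` absorbs both `T` and itself, so `U` absorbs `T + N`. -/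
theorem isVonNBounded_of_forall_subset_add {S : Set X}
    (h : ∀ U ∈ 𝓝 (0 : X), ∃ T, Bornology.IsVonNBounded ℂ T ∧ S ⊆ T + U) :
    Bornology.IsVonNBounded ℂ S := by
  intro U hU
  obtain ⟨V, hV, hVU⟩ := exists_nhds_zero_half hU
  obtain ⟨N, ⟨hN, hNb⟩, hNV⟩ := (nhds_basis_balanced ℂ X).mem_iff.1 hV
  obtain ⟨T, hT, hST⟩ := h N hN
  refine (((hT hN).add hNb.absorbs_self).mono_left ?_).mono_right hST
  rintro _ ⟨v, hv, w, hw, rfl⟩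
  exact hVU v (hNV hv) w (hNV hw)

theorem isVonNBounded_closure {S : Set X} (hS : Bornology.IsVonNBounded ℂ S) :
    Bornology.IsVonNBounded ℂ (closure S) :=
  isVonNBounded_of_forall_subset_add fun U hU ↦ ⟨S, hS, fun x hx ↦ by
    obtain ⟨y, hxy, hy⟩ := mem_closure_iff_nhds.1 hx {y | x - y ∈ U}
      (UniformSpace.ball_mem_nhds x (preimage_sub_mem_uniformity hU))
    exact ⟨y, hy, x - y, hxy, add_sub_cancel y x⟩⟩

theorem closure_subset_boundedFunctions {Ω : Type*} [TopologicalSpace Ω] {W : Set C(Ω, X)}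
    (hW : W ⊆ boundedFunctions Ω X) :
    closure[uniformTopology Ω X] W ⊆ boundedFunctions Ω X := by
  intro f hf
  rw [mem_closure_uniformTopology] at hf
  refine isVonNBounded_of_forall_subset_add fun U hU ↦ ?_
  obtain ⟨g, hg, hgf⟩ := hf _ (preimage_sub_mem_uniformity hU)
  refine ⟨Set.range g, hW hg, ?_⟩
  rintro _ ⟨t, rfl⟩
  exact ⟨g t, ⟨t, rfl⟩, f t - g t, hgf t, add_sub_cancel _ _⟩

end Bounded

/-! ### Total boundedness and approximation -/

section Approximation

variable {Ω : Type*} [TopologicalSpace Ω]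
variable {X : Type*} [AddCommGroup X] [Module ℂ X] [UniformSpace X] [IsUniformAddGroup X]

/-- A continuous image of a functionally bounded set is totally bounded with respect to every
continuous seminorm. -/
theorem IsFunctionallyBounded.exists_finite_cover {K : Set Ω} (hK : IsFunctionallyBounded K)
    {p : Seminorm ℝ X} (hp : Continuous p) (f : C(Ω, X)) {r : ℝ} (hr : 0 < r) :
    ∃ F : Set X, F.Finite ∧ ∀ t ∈ K, ∃ y ∈ F, p (f t - y) < r := by
  by_contra! hcon
  obtain ⟨u, huK, hu⟩ := exists_seq_of_forall_finset_exists (fun t ↦ t ∈ K)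
    (fun s t ↦ r ≤ p (f t - f s)) fun F _ ↦ by
      obtain ⟨t, ht, h⟩ := hcon (f '' F) (F.finite_toSet.image f)
      exact ⟨t, ht, fun x hx ↦ h _ ⟨x, hx, rfl⟩⟩
  have hne : ∀ m n, p (f (u m) - f (u n)) < r → m = n := by
    intro m n h
    rcases lt_trichotomy m n with hmn | hmn | hmn
    · rw [map_sub_rev] at h; exact absurd h (hu m n hmn).not_gt
    · exact hmn
    · exact absurd h (hu n m hmn).not_gt
  -- Bumps of height `n` at `u n`. As the `f (u n)` are `r`-apart, the radius `r / 4` lets each `r /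
  -- 4`-neighbourhood meet at most one support, so the sum is continuous yet unbounded on `K`.
  set b : ℕ → Ω → ℝ := fun n t ↦ n * max 0 (1 - 4 / r * p (f t - f (u n))) with hb
  have hbs : ∀ n t, b n t ≠ 0 → p (f t - f (u n)) < r / 4 := by
    intro n t h
    by_contra! h'
    refine h ?_
    have : 1 ≤ 4 / r * p (f t - f (u n)) := by
      rw [div_mul_eq_mul_div, one_le_div hr]; linarith
    simp [hb, max_eq_left (sub_nonpos.2 this)]
  have hlf : LocallyFinite fun n ↦ Function.support (b n) := by
    intro t
    refine ⟨{s | p (f s - f t) < r / 4}, ?_, Set.Subsingleton.finite ?_⟩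
    · exact (show Continuous fun s ↦ p (f s - f t) by fun_prop).continuousAt.eventually_lt
        continuousAt_const (by simpa using hr)
    · have hcl : ∀ n, (Function.support (b n) ∩ {s | p (f s - f t) < r / 4}).Nonempty →
          p (f t - f (u n)) < r / 2 := by
        rintro n ⟨s, hs, hst⟩
        have h1 := hbs n s hs
        have h2 := map_add_le_add p (f t - f s) (f s - f (u n))
        rw [sub_add_sub_cancel, map_sub_rev p (f t) (f s)] at h2
        change p (f s - f t) < r / 4 at hst
        linarith
      intro m hm n hn
      refine hne m n ?_
      have h2 := map_add_le_add p (f (u m) - f t) (f t - f (u n))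
      rw [sub_add_sub_cancel, map_sub_rev p (f (u m)) (f t)] at h2
      linarith [hcl m hm, hcl n hn]
  have hcont : Continuous fun t ↦ ∑ᶠ n, b n t :=
    continuous_finsum (fun n ↦ by fun_prop) hlf
  obtain ⟨B, hB⟩ := (hK ⟨_, hcont⟩).exists_norm_le
  obtain ⟨n, hn⟩ := exists_nat_gt B
  have hval : ∑ᶠ m, b m (u n) = n := by
    rw [finsum_eq_single _ n fun m hm ↦ ?_]
    · simp [hb]
    · by_contra h
      exact hm (hne n m ((hbs m _ h).trans (by linarith))).symm
  have := hB _ ⟨u n, huK n, rfl⟩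
  rw [ContinuousMap.coe_mk, hval, Real.norm_natCast] at this
  linarith

theorem exists_finite_cover_of_totallyBounded {f : C(Ω, X)} {p : Seminorm ℝ X}
    (hf : TotallyBounded (Set.range f)) (hp : Continuous p) {r : ℝ} (hr : 0 < r) :
    ∃ F : Set X, F.Finite ∧ ∀ t, ∃ y ∈ F, p (f t - y) < r := by
  obtain ⟨F, hF, h⟩ := hf _ (preimage_sub_mem_uniformity (U := {x | p x < r})
    (hp.continuousAt.eventually_lt continuousAt_const (by simpa using hr)))
  exact ⟨F, hF, fun t ↦ by simpa using h ⟨t, rfl⟩⟩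

variable [ContinuousSMul ℂ X] {W : Set C(Ω, X)} {K : Set Ω} {p : Seminorm ℝ X}

/-- Functions in `W` approximate `f` on the part of `K` which `f` maps near to a finite set of
constants belonging to `W`. -/
theorem exists_approx_of_finite
    (hsep : ∀ Z₁ Z₂ : Set Ω, IsZeroSet Z₁ → IsZeroSet Z₂ → Disjoint Z₁ Z₂ →
      MultipliersSeparate W K Z₁ Z₂)
    (hp : Continuous p) (f : C(Ω, X)) (hf : ∀ x, ∃ B, ∀ t ∈ K, p (x - f t) ≤ B)
    {x₀ : X} (hx₀ : ContinuousMap.const Ω x₀ ∈ W) {ε : ℝ} (hε : 0 < ε)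
    {F : Set X} (hF : F.Finite) (hFW : ∀ x ∈ F, ContinuousMap.const Ω x ∈ W) :
    ∀ η > 0, ∃ g ∈ W, (∃ B, ∀ t ∈ K, p (g t - f t) ≤ B) ∧
      ∀ t ∈ K, (∃ x ∈ F, p (x - f t) ≤ ε) → p (g t - f t) ≤ 2 * ε + η := by
  induction F, hF using Set.Finite.induction_on with
  | empty => exact fun η _ ↦ ⟨_, hx₀, hf x₀, by simp⟩
  | @insert x F _ _ ih =>
    intro η hη
    obtain ⟨g, hg, ⟨B, hB⟩, hgF⟩ := ih (fun y hy ↦ hFW y (Set.mem_insert_of_mem x hy)) (η / 2)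
      (by positivity)
    obtain ⟨D, hD⟩ := hf x
    -- `M` bounds both errors on `K`, so a switch of accuracy `η / (2M)` costs at most `η / 2`; this
    -- is why the induction carries a bound for `g`.
    set M : ℝ := max (max B D) 1 with hM
    have hM0 : 0 < M := lt_max_of_lt_right one_pos
    let d : C(Ω, ℝ) := ⟨fun t ↦ p (x - f t), by fun_prop⟩
    obtain ⟨φ, hφ, h1, h2⟩ := hsep _ _ (isZeroSet_le d ε) (isZeroSet_ge d (2 * ε))
      (Set.disjoint_left.2 fun t (ht : d t ≤ ε) (ht' : 2 * ε ≤ d t) ↦ by linarith)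
      (η / (2 * M)) (by positivity)
    have hδ : η / (2 * M) * M = η / 2 := by field_simp
    have hest : ∀ t ∈ K, p ((φ • ContinuousMap.const Ω x + (1 - φ) • g) t - f t) ≤
        (φ t).re * d t + (1 - (φ t).re) * p (g t - f t) := by
      intro t ht
      obtain ⟨h0, h1⟩ := re_mem_Icc_of_mem_unitMultipliers hφ ht
      have e : (φ • ContinuousMap.const Ω x + (1 - φ) • g) t - f t =
          (φ t).re • (x - f t) + (1 - (φ t).re) • (g t - f t) := by
        simp only [ContinuousMap.add_apply, ContinuousMap.smul_apply', ContinuousMap.sub_apply,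
          ContinuousMap.one_apply, ContinuousMap.const_apply]
        rw [← Complex.coe_smul, ← Complex.coe_smul, Complex.ofReal_sub, Complex.ofReal_one,
          ofReal_re_of_mem_unitMultipliers hφ ht]
        module
      rw [e]
      refine (map_add_le_add p _ _).trans_eq ?_
      rw [map_smul_eq_mul, map_smul_eq_mul, Real.norm_of_nonneg h0,
        Real.norm_of_nonneg (sub_nonneg.2 h1)]
      rfl
    have hgM : ∀ t ∈ K, p (g t - f t) ≤ M := fun t ht ↦
      (hB t ht).trans ((le_max_left _ _).trans (le_max_left _ _))
    have hdM : ∀ t ∈ K, d t ≤ M := fun t ht ↦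
      (hD t ht).trans ((le_max_right _ _).trans (le_max_left _ _))
    refine ⟨_, hφ.1 _ (hFW x (Set.mem_insert x F)) g hg, ⟨M, fun t ht ↦ ?_⟩, ?_⟩
    · obtain ⟨h0, h1⟩ := re_mem_Icc_of_mem_unitMultipliers hφ ht
      nlinarith [hest t ht, hgM t ht, hdM t ht]
    · rintro t ht ⟨y, hy, hyt⟩
      obtain ⟨h0, h1'⟩ := re_mem_Icc_of_mem_unitMultipliers hφ ht
      have hd0 : 0 ≤ d t := apply_nonneg p _
      have hg0 : 0 ≤ p (g t - f t) := apply_nonneg p _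
      refine (hest t ht).trans ?_
      -- Near `x` the constant dominates; beyond `2ε` the old `g` does; in between both errors are
      -- at most `2ε + η / 2`, and so is their convex combination.
      by_cases hsmall : d t ≤ ε
      · have h3 : (1 - (φ t).re) * p (g t - f t) ≤ η / (2 * M) * M :=
          mul_le_mul (by linarith [h1 t ht hsmall]) (hgM t ht) hg0 (by positivity)
        have h4 : (φ t).re * d t ≤ 1 * ε := mul_le_mul h1' hsmall hd0 zero_le_one
        linarith
      · have hyF : y ∈ F := hy.resolve_left (by rintro rfl; exact hsmall hyt)
        have hgt := hgF t ht ⟨y, hyF, hyt⟩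
        by_cases hbig : 2 * ε ≤ d t
        · have h3 : (φ t).re * d t ≤ η / (2 * M) * M :=
            mul_le_mul (h2 t ht hbig) (hdM t ht) hd0 (by positivity)
          have h4 : (1 - (φ t).re) * p (g t - f t) ≤ 1 * (2 * ε + η / 2) :=
            mul_le_mul (by linarith) hgt hg0 zero_le_one
          linarith
        · nlinarith

/-- If `f` maps `K` to a set which is totally bounded for `p`, then `f` is approximated on `K`
by members of `W`. -/
theorem exists_approx_of_finite_cover
    (hsep : ∀ Z₁ Z₂ : Set Ω, IsZeroSet Z₁ → IsZeroSet Z₂ → Disjoint Z₁ Z₂ →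
      MultipliersSeparate W K Z₁ Z₂)
    (hconst : ContainsDenseConstants W) (hp : Continuous p) (f : C(Ω, X))
    (hf : ∀ r > 0, ∃ F : Set X, F.Finite ∧ ∀ t ∈ K, ∃ y ∈ F, p (f t - y) < r)
    {ε : ℝ} (hε : 0 < ε) : ∃ g ∈ W, ∀ t ∈ K, p (g t - f t) < ε := by
  obtain ⟨X₀, hX₀, hW⟩ := hconst
  have hbd : ∀ x, ∃ B, ∀ t ∈ K, p (x - f t) ≤ B := by
    intro x
    obtain ⟨F, hF, hFK⟩ := hf 1 one_pos
    obtain ⟨B, hB⟩ := (hF.image fun y ↦ p (x - y)).bddAbove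
    refine ⟨B + 1, fun t ht ↦ ?_⟩
    obtain ⟨y, hy, hyt⟩ := hFK t ht
    have h := map_add_le_add p (x - y) (y - f t)
    rw [sub_add_sub_cancel, map_sub_rev p y] at h
    linarith [hB ⟨y, hy, rfl⟩]
  obtain ⟨x₀, hx₀⟩ := hX₀.nonempty
  obtain ⟨F, hF, hFK⟩ := hf (ε / 8) (by positivity)
  have hdense : ∀ y, ∃ x ∈ X₀, p (x - y) < ε / 8 := fun y ↦
    hX₀.exists_mem_open (U := {x | p (x - y) < ε / 8})
      (isOpen_lt (by fun_prop) continuous_const) ⟨y, by simpa using hε⟩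
  choose c hcX hc using hdense
  -- Cover radius plus density error is `ε / 4`; the result is then within `2 * (ε / 4) + ε / 4 <
  -- ε`.
  obtain ⟨g, hg, -, hgK⟩ := exists_approx_of_finite hsep hp f hbd (hW x₀ hx₀)
    (ε := ε / 4) (by positivity) (hF.image c)
    (by rintro _ ⟨y, -, rfl⟩; exact hW _ (hcX y)) (ε / 4) (by positivity)
  refine ⟨g, hg, fun t ht ↦ (hgK t ht ?_).trans_lt (by linarith)⟩
  obtain ⟨y, hy, hyt⟩ := hFK t ht
  refine ⟨c y, ⟨y, hy, rfl⟩, ?_⟩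
  have h := map_add_le_add p (c y - y) (y - f t)
  rw [sub_add_sub_cancel, map_sub_rev p y] at h
  linarith [hc y]

variable [LocallyConvexSpace ℝ X]

/-- Entourages of a locally convex space contain the entourages of continuous seminorms. -/
theorem exists_continuous_seminorm_of_mem_uniformity {V : Set (X × X)} (hV : V ∈ uniformity X) :
    ∃ p : Seminorm ℝ X, Continuous p ∧ ∀ x y, p (x - y) < 1 → (x, y) ∈ V := by
  have : ContinuousSMul ℝ X := continuousSMul_real_of_complex
  rw [uniformity_eq_comap_nhds_zero_swapped] at hV
  obtain ⟨U, hU, hUV⟩ := hV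
  obtain ⟨S, ⟨hS0, hSo, hSb, hSc⟩, hSU⟩ := (nhds_hasBasis_absConvex_open ℝ X).mem_iff.1 hU
  have hS : S ∈ 𝓝 (0 : X) := hSo.mem_nhds hS0
  have hball := gaugeSeminorm_ball_one (hs₀ := hSb) (hs₁ := hSc)
    (hs₂ := absorbent_nhds_zero hS) hSo
  refine ⟨gaugeSeminorm hSb hSc (absorbent_nhds_zero hS),
    Seminorm.continuous (r := 1) (by rwa [hball]), fun x y hxy ↦ hUV (hSU ?_)⟩
  exact hball.subset ((Seminorm.mem_ball_zero _).2 hxy)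

theorem exists_approx_entourage
    (hsep : ∀ Z₁ Z₂ : Set Ω, IsZeroSet Z₁ → IsZeroSet Z₂ → Disjoint Z₁ Z₂ →
      MultipliersSeparate W K Z₁ Z₂)
    (hconst : ContainsDenseConstants W) (f : C(Ω, X))
    (hf : ∀ p : Seminorm ℝ X, Continuous p → ∀ r > 0, ∃ F : Set X, F.Finite ∧
      ∀ t ∈ K, ∃ y ∈ F, p (f t - y) < r)
    {V : Set (X × X)} (hV : V ∈ uniformity X) : ∃ g ∈ W, ∀ t ∈ K, (g t, f t) ∈ V := by
  obtain ⟨p, hp, hpV⟩ := exists_continuous_seminorm_of_mem_uniformity hV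
  obtain ⟨g, hg, hgK⟩ := exists_approx_of_finite_cover hsep hconst hp f (hf p hp) one_pos
  exact ⟨g, hg, fun t ht ↦ hpV _ _ (hgK t ht)⟩

end Approximation

end SWApprox

theorem mainTheorem4
    {Ω : Type*} [TopologicalSpace Ω]
    {X : Type*} [AddCommGroup X] [Module ℂ X] [UniformSpace X] [IsUniformAddGroup X]
    [ContinuousSMul ℂ X] [LocallyConvexSpace ℝ X]
    (hΩX : ¬ T2Space X → CompletelyRegularSpace Ω ∧ T2Space Ω)
    (A : Set C(Ω, ℂ)) (W : Set C(Ω, X))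
    (hA : SWApprox.UnitIntervalValued A ∨ SWApprox.IsSelfAdjointSubalgebra A)
    (hAW : SWApprox.IsMultiplier A W)
    (hsep : SWApprox.SeparatesDisjointZeroSets A)
    (hconst : SWApprox.ContainsDenseConstants W) :
    -- (a)
    (W ⊆ SWApprox.relCompactRange Ω X → (∀ φ ∈ A, Bornology.IsBounded (Set.range φ)) →
      SWApprox.relCompactRange Ω X ⊆ closure[SWApprox.uniformTopology Ω X] W) ∧
    -- (b)
    (SWApprox.HeineBorel X →
      closure[SWApprox.boundedOpenTopology Ω X] W = Set.univ ∧
      (W ⊆ SWApprox.boundedFunctions Ω X → (∀ φ ∈ A, Bornology.IsBounded (Set.range φ)) →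
        closure[SWApprox.uniformTopology Ω X] W = SWApprox.boundedFunctions Ω X)) ∧
    -- (c)
    ((𝓝 (0 : X)).IsCountablyGenerated →
      closure[SWApprox.pseudocompactOpenTopology Ω X] W = Set.univ) := by
  have uniform : (∀ φ ∈ A, Bornology.IsBounded (Set.range φ)) →
      SWApprox.relCompactRange Ω X ⊆ closure[SWApprox.uniformTopology Ω X] W := by
    intro hbd f hf
    rw [SWApprox.mem_closure_uniformTopology]
    intro V hV
    obtain ⟨g, hg, hgV⟩ := SWApprox.exists_approx_entourage (K := Set.univ)
      (fun _ _ ↦ SWApprox.multipliersSeparate_zeroSets hA hAW hsep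
        fun φ hφ ↦ by simpa using hbd φ hφ) hconst f
      (fun p hp r hr ↦ by
        simpa using SWApprox.exists_finite_cover_of_totallyBounded
          (hf.totallyBounded.subset subset_closure) hp hr) (UniformSpace.symm hV)
    exact ⟨g, hg, fun t ↦ hgV t trivial⟩
  have bounded : closure[SWApprox.boundedOpenTopology Ω X] W = Set.univ := by
    refine Set.eq_univ_of_forall fun f ↦ SWApprox.mem_closure_boundedOpenTopology
      fun K hK V hV ↦ SWApprox.exists_approx_entourage
        (fun _ _ ↦ SWApprox.multipliersSeparate_zeroSets hA hAW hsep fun φ _ ↦ ?_) hconst f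
        (fun p hp r hr ↦ hK.exists_finite_cover hp f hr) hV
    -- Members of `A` are bounded on `K` because `‖φ‖` is a continuous real function.
    obtain ⟨R, hR⟩ := (hK ⟨fun t ↦ ‖φ t‖, by fun_prop⟩).exists_norm_le
    refine isBounded_iff_forall_norm_le.2 ⟨R, ?_⟩
    rintro _ ⟨t, ht, rfl⟩
    simpa using hR _ ⟨t, ht, rfl⟩
  refine ⟨fun _ ↦ uniform, fun hHB ↦ ⟨bounded, fun hW hbd ↦
    (SWApprox.closure_subset_boundedFunctions hW).antisymm fun f hf ↦ uniform hbd ?_⟩,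
    fun _ ↦ Set.univ_subset_iff.1 (bounded ▸
      closure.mono SWApprox.boundedOpenTopology_le_pseudocompactOpenTopology)⟩
  -- Heine-Borel makes bounded ranges relatively compact, so the uniform density result applies.
  exact hHB _ isClosed_closure (SWApprox.isVonNBounded_closure hf)
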